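/- Let $A$ be an $n\times n$ real matrix in real Jordan canonical form, that is, a block diagonal matrix each of whose diagonal blocks is either a $p\times p$ matrix ($p\ge 1$) with a real number $\lambda$ on the diagonal, $1$ on the superdiagonal and $0$ elsewhere, or a $2m\times 2m$ matrix ($m\ge 1$) made of $2\times 2$ blocks, with $\Lambda=\begin{pmatrix}a&b\\-b&a\end{pmatrix}$ ($a,b\in\mathbb{R}$, $b>0$) in the diagonal blocks, the identity $I_2$ in the superdiagonal blocks and $0$ elsewhere. Let $S$ be the set of all $x\in\mathbb{R}^n$ with $\prod_{i=1}^n x_i\neq 0$. For a solution $r(t)$ of $\dot r(t)=Ar(t)$, let $$\kappa(t)=\frac{1}{\|\dot r(t)\|}\left\|\frac{d}{dt}\frac{\dot r(t)}{\|\dot r(t)\|}\right\|=\frac{\left\|\ddot r(t)-\frac{\langle \ddot r(t),\dot r(t)\rangle}{\langle \dot r(t),\dot r(t)\rangle}\,\dot r(t)\right\|}{\|\dot r(t)\|^{2}}$$ be its first curvature, where $\|\cdot\|$ is the Euclidean norm and $\kappa\equiv 0$ if $r$ is constant. Then: 1. If $\lim_{t\to+\infty}\kappa(t)=0$ for some solution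 with $r(0)\in S$, then $\lim_{t\to+\infty}\kappa(t)=0$ for every solution with $r(0)\in S$. 2. If $\lim_{t\to+\infty}\kappa(t)=+\infty$ for some solution with $r(0)\in S$, then $\lim_{t\to+\infty}\kappa(t)=+\infty$ for every solution with $r(0)\in S$. 3. If for some solution with $r(0)\in S$ the limit $\lim_{t\to+\infty}\kappa(t)$ exists and is a constant $C>0$, then for every solution with $r(0)\in S$ the limit $\lim_{t\to+\infty}\kappa(t)$ exists and is a constant $\tilde C>0$ (which may depend on $r(0)$). 4. If $\kappa$ is a bounded function on $[0,+\infty)$ for some solution with $r(0)\in S$, then $\kappa$ is a bounded function on $[0,+\infty)$ for every solution with $r(0)\in S$. -/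

import Mathlib

open Filter Topology

noncomputable section

/-- The data of a real Jordan block: either a block with a real eigenvalue `l` of order `p ≥ 1`,
or a block of order `2m`, `m ≥ 1`, with the conjugate eigenvalues `a ± b i`, `b > 0`. -/
inductive RealJordanBlock : Type
  | real (p : ℕ) (hp : 0 < p) (l : ℝ) : RealJordanBlock
  | complex (m : ℕ) (hm : 0 < m) (a b : ℝ) (hb : 0 < b) : RealJordanBlock

namespace RealJordanBlock

/-- The order (number of rows) of a real Jordan block. -/
def size : RealJordanBlock → ℕ
  | real p _ _ => p
  | complex m _ _ _ _ => m * 2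

/-- The `p × p` matrix with `l` on the diagonal, `1` on the superdiagonal, `0` elsewhere. -/
def realMatrix (p : ℕ) (l : ℝ) : Matrix (Fin p) (Fin p) ℝ :=
  Matrix.of fun i j =>
    if i = j then l else if (i : ℕ) + 1 = (j : ℕ) then 1 else 0

/-- The `2m × 2m` matrix made of `2 × 2` blocks, with `!![a, b; -b, a]` in the diagonal blocks,
the identity matrix in the superdiagonal blocks, and `0` elsewhere. The equivalence
`finProdFinEquiv` sends (block `k`, row `s` inside that block) to the row `2k + s`. -/
def complexMatrix (m : ℕ) (a b : ℝ) : Matrix (Fin (m * 2)) (Fin (m * 2)) ℝ :=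
  Matrix.reindex finProdFinEquiv finProdFinEquiv
    (Matrix.of fun (x y : Fin m × Fin 2) =>
      if x.1 = y.1 then (!![a, b; -b, a] : Matrix (Fin 2) (Fin 2) ℝ) x.2 y.2
      else if (x.1 : ℕ) + 1 = (y.1 : ℕ) then (1 : Matrix (Fin 2) (Fin 2) ℝ) x.2 y.2
      else 0)

/-- The matrix of a real Jordan block. -/
def toMatrix : (B : RealJordanBlock) → Matrix (Fin B.size) (Fin B.size) ℝ
  | real p _ l => realMatrix p l
  | complex m _ a b _ => complexMatrix m a b

end RealJordanBlock

/-- `A` is in real Jordan canonical form: it is the block diagonal matrix of finitely many real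
Jordan blocks placed one after the other along the diagonal (`finSigmaFinEquiv` is the
order-preserving enumeration of the rows: those of the first block, then those of the second
block, and so on). -/
def IsRealJordanForm {n : ℕ} (A : Matrix (Fin n) (Fin n) ℝ) : Prop :=
  ∃ (q : ℕ) (B : Fin q → RealJordanBlock) (h : ∑ i, (B i).size = n),
    A = Matrix.reindex (finSigmaFinEquiv.trans (finCongr h)) (finSigmaFinEquiv.trans (finCongr h))
      (Matrix.blockDiagonal' fun i => (B i).toMatrix)

/-- The curve `r` is a trajectory of the linear time-invariant system `r' = A r`. -/
def IsTrajectory {n : ℕ} (A : Matrix (Fin n) (Fin n) ℝ) (r : ℝ → EuclideanSpace ℝ (Fin n)) :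
    Prop :=
  ∀ t : ℝ, HasDerivAt r (WithLp.toLp 2 (A.mulVec (r t).ofLp)) t

/-- The set of initial values all of whose coordinates are nonzero. -/
def nonzeroCoordSet (n : ℕ) : Set (EuclideanSpace ℝ (Fin n)) :=
  {x | ∏ i, x i ≠ 0}

/-- The unit tangent vector of a curve with an arbitrary regular parameter. -/
def unitTangent {n : ℕ} (r : ℝ → EuclideanSpace ℝ (Fin n)) (t : ℝ) : EuclideanSpace ℝ (Fin n) :=
  ‖deriv r t‖⁻¹ • deriv r t

/-- The first curvature of a curve with an arbitrary regular parameter: the norm of the derivative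
of the unit tangent vector with respect to arc length. For a constant curve its value is `0`. -/
def firstCurvature {n : ℕ} (r : ℝ → EuclideanSpace ℝ (Fin n)) (t : ℝ) : ℝ :=
  ‖deriv (unitTangent r) t‖ / ‖deriv r t‖

/-- The expression of the first curvature through the Gram-Schmidt process applied to the first two
derivatives. -/
theorem firstCurvature_eq_gramSchmidt {n : ℕ} (r : ℝ → EuclideanSpace ℝ (Fin n)) (t : ℝ)
    (hr : DifferentiableAt ℝ (deriv r) t) (h0 : deriv r t ≠ 0) :
    firstCurvature r t =
      ‖deriv (deriv r) t -
        (inner ℝ (deriv (deriv r) t) (deriv r t) / inner ℝ (deriv r t) (deriv r t)) • deriv r t‖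
        / ‖deriv r t‖ ^ 2 := by
  have hv : HasDerivAt (deriv r) (deriv (deriv r) t) t := hr.hasDerivAt
  have hn0 : ‖deriv r t‖ ≠ 0 := norm_ne_zero_iff.mpr h0
  have hsq : HasDerivAt (fun s => ‖deriv r s‖ ^ 2)
      (2 * inner ℝ (deriv r t) (deriv (deriv r) t)) t := hv.norm_sq
  have hnorm : HasDerivAt (fun s => ‖deriv r s‖)
      (2 * inner ℝ (deriv r t) (deriv (deriv r) t) / (2 * ‖deriv r t‖)) t := by
    have h := hsq.sqrt (pow_ne_zero 2 hn0)
    simpa [Real.sqrt_sq (norm_nonneg _)] using h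
  have hT : HasDerivAt (unitTangent r) _ t := (hnorm.inv hn0).smul hv
  rw [firstCurvature, hT.deriv]
  have key : (‖deriv r t‖⁻¹ • deriv (deriv r) t +
      (-(2 * inner ℝ (deriv r t) (deriv (deriv r) t) / (2 * ‖deriv r t‖)) / ‖deriv r t‖ ^ 2) •
        deriv r t) = ‖deriv r t‖⁻¹ • (deriv (deriv r) t -
        (inner ℝ (deriv (deriv r) t) (deriv r t) / inner ℝ (deriv r t) (deriv r t)) • deriv r t) := by
    rw [smul_sub, smul_smul, sub_eq_add_neg, ← neg_smul, real_inner_self_eq_norm_sq,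
      real_inner_comm (deriv r t)]
    congr 2
    field_simp
  have e := congrArg norm key
  simp only [Pi.inv_apply] at e ⊢
  rw [e, norm_smul, norm_inv, norm_norm]
  field_simp

end

/-! The squared curvature is `κ² = G / ‖r'‖⁶`, where `G` is the Gram determinant of velocity and
acceleration. The point is that, for large `t`, its order of magnitude does not depend on the
initial value in `S`.

Pair the real coordinates of each complex block into complex ones. The velocity then splits into
chains `v k' = μ * v k + v (k + 1)`, so each coordinate is `exp (μ t)` times a polynomial. Nonzero
initial coordinates make that polynomial of the largest possible degree `d`. Hence the modulus of
the coordinate is of exact order `exp (Re μ t) * t ^ d`, and its logarithmic derivative is `μ + d /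
t + O(t⁻²)`; `μ` and `d` come from the matrix alone.

A Lagrange identity writes `2G` as a sum over pairs of coordinates of `‖v‖² ‖w‖² ratioGap p q`, with
`p`, `q` the logarithmic derivatives. All terms are nonnegative, so nothing cancels and `G` is at
least as large as any single term. The order of a gap is fixed by `μ` and `d`, except for equal real
eigenvalues and equal positive degrees, where only an upper bound `O(t⁻⁴)` is available. Such a pair
is absorbed by the pair of one of its coordinates with its successor in the same block
(`scale_isBigO_areaSum`). Therefore any two trajectories have curvatures that are `O` of each other
(`sq_curvature_isBigO`). This gives statements 1 and 2, and statement 4 together with continuity of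
`κ` on compact intervals.

Statement 3 also needs a limit to exist. Inner products inside one chain cancel the phases `exp (i
Im μ t)`, so `G` and `‖r'‖²` are exponential polynomials with real exponents, and a bounded quotient
of two such functions converges (`exists_tendsto_div_of_mem_expPoly`). Comparison with the given
trajectory shows that the limit is not zero. -/

open Asymptotics

/-! ### Growth of exponential polynomials with real exponents -/

/-- The monomial `exp (l t) * t ^ k`, indexed lexicographically by its order of growth. -/
noncomputable def expMonomial (x : ℝ ×ₗ ℕ) (t : ℝ) : ℝ := Real.exp ((ofLex x).1 * t) * t ^ (ofLex x).2

theorem expMonomial_pos (x : ℝ ×ₗ ℕ) {t : ℝ} (ht : 0 < t) : 0 < expMonomial x t := by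
  unfold expMonomial; positivity

theorem tendsto_expMonomial_div {x y : ℝ ×ₗ ℕ} (h : x < y) :
    Tendsto (fun t => expMonomial x t / expMonomial y t) atTop (𝓝 0) := by
  rcases Prod.Lex.lt_iff.1 h with h1 | ⟨h1, h2⟩
  · have hb : 0 < (ofLex y).1 - (ofLex x).1 := sub_pos.2 h1
    have h3 := tendsto_rpow_mul_exp_neg_mul_atTop_nhds_zero
      (((ofLex x).2 : ℝ) - (ofLex y).2) _ hb
    refine h3.congr' ?_
    filter_upwards [eventually_gt_atTop 0] with t ht
    rw [expMonomial, expMonomial, Real.rpow_sub ht, Real.rpow_natCast, Real.rpow_natCast,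
      mul_div_mul_comm, ← Real.exp_sub, mul_comm]
    congr 2
    ring
  · have h3 := (tendsto_pow_atTop (α := ℝ) (n := (ofLex y).2 - (ofLex x).2)
      (by omega)).inv_tendsto_atTop
    refine h3.congr' ?_
    filter_upwards [eventually_gt_atTop 0] with t ht
    simp only [expMonomial, Pi.inv_apply]
    rw [h1, mul_div_mul_left _ _ (Real.exp_pos _).ne', pow_sub₀ _ ht.ne' h2.le]
    field_simp

/-- The algebra of exponential polynomials with real exponents. -/
def expPoly : Subalgebra ℝ (ℝ → ℝ) :=
  Algebra.adjoin ℝ (insert id (Set.range fun l t => Real.exp (l * t)))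

theorem id_mem_expPoly : (fun t => t) ∈ expPoly :=
  Algebra.subset_adjoin (Set.mem_insert _ _)

theorem exp_mem_expPoly (l : ℝ) : (fun t => Real.exp (l * t)) ∈ expPoly :=
  Algebra.subset_adjoin (Set.mem_insert_of_mem _ ⟨l, rfl⟩)

theorem const_mem_expPoly (c : ℝ) : (fun _ => c) ∈ expPoly :=
  expPoly.algebraMap_mem c

/-- The generators are monomials and monomials are closed under products, so the submonoid they
generate already spans the algebra. -/
theorem expPoly_le_span :
    Subalgebra.toSubmodule expPoly ≤ Submodule.span ℝ (Set.range expMonomial) := by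
  rw [expPoly, Algebra.adjoin_eq_span]
  refine Submodule.span_mono fun f hf => ?_
  induction hf using Submonoid.closure_induction with
  | mem f hf =>
    rcases hf with rfl | ⟨l, rfl⟩
    · exact ⟨toLex (0, 1), by funext t; simp [expMonomial]⟩
    · exact ⟨toLex (l, 0), by funext t; simp [expMonomial]⟩
  | one => exact ⟨toLex (0, 0), by funext t; simp [expMonomial]⟩
  | mul f g _ _ hf hg =>
    obtain ⟨x, rfl⟩ := hf
    obtain ⟨y, rfl⟩ := hg
    refine ⟨toLex ((ofLex x).1 + (ofLex y).1, (ofLex x).2 + (ofLex y).2), ?_⟩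
    funext t
    simp only [expMonomial, ofLex_toLex, Pi.mul_apply, add_mul, Real.exp_add, pow_add]
    ring

/-- The lexicographically largest monomial in the support dominates all the others, and the limit is
its coefficient. -/
theorem eq_zero_or_tendsto_of_mem_expPoly {f : ℝ → ℝ} (hf : f ∈ expPoly) :
    f = 0 ∨ ∃ (x : ℝ ×ₗ ℕ) (c : ℝ), c ≠ 0 ∧
      Tendsto (fun t => f t / expMonomial x t) atTop (𝓝 c) := by
  obtain ⟨c, rfl⟩ := Finsupp.mem_span_range_iff_exists_finsupp.1 (expPoly_le_span hf)
  by_cases hc : c = 0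
  · left; simp [hc]
  right
  have hne : c.support.Nonempty := Finsupp.support_nonempty_iff.2 hc
  set x := c.support.max' hne with hx
  have hxm : x ∈ c.support := Finset.max'_mem _ _
  refine ⟨x, c x, Finsupp.mem_support_iff.1 hxm, ?_⟩
  have h1 : Tendsto (fun t => ∑ y ∈ c.support, c y * (expMonomial y t / expMonomial x t)) atTop
      (𝓝 (∑ y ∈ c.support, if y = x then c x else 0)) := by
    refine tendsto_finsetSum _ fun y hy => ?_
    by_cases hyx : y = x
    · rw [if_pos hyx, hyx]
      refine tendsto_const_nhds.congr' ?_
      filter_upwards [eventually_gt_atTop 0] with t ht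
      rw [div_self (expMonomial_pos x ht).ne', mul_one]
    · rw [if_neg hyx]
      have hlt : y < x := lt_of_le_of_ne (Finset.le_max' _ _ hy) hyx
      simpa using (tendsto_expMonomial_div hlt).const_mul (c y)
  rw [Finset.sum_ite_eq' , if_pos hxm] at h1
  refine h1.congr fun t => ?_
  simp only [Finsupp.sum, Finset.sum_apply, Pi.smul_apply, smul_eq_mul, Finset.sum_div, mul_div_assoc]

/-- Leading monomials decide: the quotient converges unless the numerator has the larger one. In
that case `g / f` tends to `0`, which is incompatible with `f / g` being bounded, since their
product is eventually `1`. -/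
theorem exists_tendsto_div_of_mem_expPoly {f g : ℝ → ℝ} (hf : f ∈ expPoly) (hg : g ∈ expPoly)
    (hb : (fun t => f t / g t) =O[atTop] fun _ => (1 : ℝ)) :
    ∃ L, Tendsto (fun t => f t / g t) atTop (𝓝 L) := by
  rcases eq_zero_or_tendsto_of_mem_expPoly hf with rfl | ⟨x, c, hc, hx⟩
  · exact ⟨0, by simp⟩
  rcases eq_zero_or_tendsto_of_mem_expPoly hg with rfl | ⟨y, d, hd, hy⟩
  · exact ⟨0, by simp⟩
  have key (x y : ℝ ×ₗ ℕ) : (fun t => (f t / expMonomial x t) / (g t / expMonomial y t) *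
      (expMonomial x t / expMonomial y t)) =ᶠ[atTop] fun t => f t / g t := by
    filter_upwards [eventually_gt_atTop 0] with t ht
    have h1 := (expMonomial_pos x ht).ne'
    have h2 := (expMonomial_pos y ht).ne'
    rw [div_div_div_eq]
    by_cases hgt : g t = 0
    · simp [hgt]
    field_simp
  rcases lt_trichotomy x y with h | rfl | h
  · exact ⟨_, ((hx.div hy hd).mul (tendsto_expMonomial_div h)).congr' (key x y)⟩
  · refine ⟨c / d, (hx.div hy hd).congr' ?_⟩
    filter_upwards [eventually_gt_atTop 0] with t ht
    exact div_div_div_cancel_right₀ (expMonomial_pos x ht).ne' _ _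
  · exfalso
    have h1 := ((hy.div hx hc).mul (tendsto_expMonomial_div h))
    rw [mul_zero] at h1
    have h2 : (fun _ : ℝ => (1 : ℝ)) =ᶠ[atTop] fun t => (f t / g t) *
        ((g t / expMonomial y t) / (f t / expMonomial x t) *
          (expMonomial y t / expMonomial x t)) := by
      filter_upwards [eventually_gt_atTop 0, hx.eventually_ne hc, hy.eventually_ne hd]
        with t ht hxt hyt
      have h3 := (expMonomial_pos x ht).ne'
      have h4 := (expMonomial_pos y ht).ne'
      have h5 : f t ≠ 0 := fun h => hxt (by simp [h])
      have h6 : g t ≠ 0 := fun h => hyt (by simp [h])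
      field_simp
    have h3 := (hb.mul_isLittleO ((isLittleO_one_iff ℝ).2 h1)).congr' h2.symm
      (Eventually.of_forall fun _ => mul_one (1 : ℝ))
    rw [isLittleO_one_iff] at h3
    exact one_ne_zero (tendsto_nhds_unique tendsto_const_nhds h3)

/-! ### Jordan chains: closed form, growth and logarithmic derivatives -/

/-- The complex coordinates `v 0, …, v (L - 1)` of a solution of `v' = J v` for a Jordan block `J`
of order `L` with eigenvalue `μ`, extended by zero. -/
structure IsJordanChain (μ : ℂ) (L : ℕ) (v : ℕ → ℝ → ℂ) : Prop where
  hasDerivAt : ∀ k t, HasDerivAt (v k) (μ * v k t + v (k + 1) t) t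
  eq_zero : ∀ k t, L ≤ k → v k t = 0
  ne_zero : ∀ k, k + 1 = L → v k 0 ≠ 0
  im_eq_zero : μ.im = 0 → ∀ k t, (v k t).im = 0

theorem hasDerivAt_sum_pow_div_factorial (c : ℕ → ℂ) (d : ℕ) (t : ℝ) :
    HasDerivAt (fun s : ℝ => ∑ j ∈ Finset.range (d + 1), c j * (s : ℂ) ^ j / (j.factorial : ℂ))
      (∑ j ∈ Finset.range d, c (j + 1) * (t : ℂ) ^ j / (j.factorial : ℂ)) t := by
  have h0 : HasDerivAt (fun s : ℝ => (s : ℂ)) 1 t := Complex.ofRealCLM.hasDerivAt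
  have h := HasDerivAt.fun_sum (u := Finset.range (d + 1)) fun j _ =>
    ((h0.pow j).const_mul (c j)).div_const (j.factorial : ℂ)
  refine h.congr_deriv ?_
  rw [Finset.sum_range_succ']
  simp only [Nat.cast_zero, zero_mul, mul_zero, zero_div, add_zero]
  refine Finset.sum_congr rfl fun j _ => ?_
  have : (j.factorial : ℂ) ≠ 0 := by exact_mod_cast j.factorial_ne_zero
  have : (j + 1 : ℂ) ≠ 0 := by exact_mod_cast j.succ_ne_zero
  rw [Nat.factorial_succ]
  push_cast
  simp only [mul_one]
  field_simp

namespace IsJordanChain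

variable {μ : ℂ} {L : ℕ} {v : ℕ → ℝ → ℂ}

/-- The polynomial part of the `k`-th coordinate of a Jordan chain. -/
noncomputable def polyPart (v : ℕ → ℝ → ℂ) (d k : ℕ) (t : ℝ) : ℂ :=
  ∑ j ∈ Finset.range d, v (k + j) 0 * (t : ℂ) ^ j / (j.factorial : ℂ)

/-- Induction from the end of the chain: once `v (k + 1)` is known, `exp (-μ t) * v k` and the
polynomial have the same derivative and the same value at `0`. The number `d` may exceed the
remaining length, because the extra coefficients vanish. -/
theorem eq_exp_mul (h : IsJordanChain μ L v) (d : ℕ) :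
    ∀ k, L ≤ k + d → ∀ t, v k t = Complex.exp (μ * t) * polyPart v d k t := by
  induction d with
  | zero => intro k hk t; simp [polyPart, h.eq_zero k t (by omega)]
  | succ d ih =>
    intro k hk t
    have hE (s : ℝ) : HasDerivAt (fun s : ℝ => Complex.exp (-μ * s))
        (Complex.exp (-μ * s) * -μ) s := by
      have h0 : HasDerivAt (fun s : ℝ => -μ * (s : ℂ)) (-μ) s := by
        simpa using (Complex.ofRealCLM.hasDerivAt (x := s)).const_mul (-μ)
      exact h0.cexp
    have hd (s : ℝ) : HasDerivAt (fun s : ℝ => Complex.exp (-μ * s) * v k s -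
        polyPart v (d + 1) k s) 0 s := by
      refine (((hE s).mul (h.hasDerivAt k s)).sub
        (hasDerivAt_sum_pow_div_factorial (fun j => v (k + j) 0) d s)).congr_deriv ?_
      rw [ih (k + 1) (by omega) s]
      have he : Complex.exp (-μ * s) * Complex.exp (μ * s) = 1 := by
        rw [← Complex.exp_add]; simp
      have hp : polyPart v d (k + 1) s =
          ∑ j ∈ Finset.range d, v (k + (j + 1)) 0 * (s : ℂ) ^ j / (j.factorial : ℂ) := by
        refine Finset.sum_congr rfl fun j _ => ?_
        rw [add_right_comm, add_assoc]
      rw [← hp]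
      linear_combination (polyPart v d (k + 1) s) * he
    have hc := is_const_of_deriv_eq_zero (fun s => (hd s).differentiableAt)
      (fun s => (hd s).deriv) t 0
    have h00 : polyPart v (d + 1) k 0 = v k 0 := by
      rw [polyPart, Finset.sum_range_succ']
      simp
    simp only [h00, Complex.ofReal_zero, mul_zero, Complex.exp_zero, one_mul, sub_self] at hc
    rw [← sub_eq_zero.1 hc, ← mul_assoc, ← Complex.exp_add]
    simp

theorem norm_ofReal_pow (t : ℝ) (j : ℕ) : ‖(t : ℂ) ^ j‖ = ‖t ^ j‖ := by
  rw [norm_pow, Complex.norm_real, norm_pow]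

theorem isLittleO_ofReal_pow {i j : ℕ} (h : i < j) (c : ℂ) :
    (fun t : ℝ => c * (t : ℂ) ^ i) =o[atTop] fun t : ℝ => (t : ℂ) ^ j := by
  refine IsLittleO.const_mul_left ?_ c
  have h1 : (fun t : ℝ => t ^ i) =o[atTop] fun t : ℝ => t ^ j := isLittleO_pow_pow_atTop_of_lt h
  exact ((h1.norm_norm.congr (fun t => (norm_ofReal_pow t i).symm)
    fun t => (norm_ofReal_pow t j).symm)).of_norm_norm

theorem isLittleO_sum_pow (c : ℕ → ℂ) (d : ℕ) :
    (fun t : ℝ => ∑ j ∈ Finset.range d, c j * (t : ℂ) ^ j / (j.factorial : ℂ)) =o[atTop]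
      fun t : ℝ => (t : ℂ) ^ d := by
  refine IsLittleO.fun_sum fun j hj => ?_
  refine (isLittleO_ofReal_pow (Finset.mem_range.1 hj) (c j / (j.factorial : ℂ))).congr_left
    fun t => ?_
  ring

theorem isTheta_polyPart (v : ℕ → ℝ → ℂ) (d k : ℕ) (h : v (k + d) 0 ≠ 0) :
    polyPart v (d + 1) k =Θ[atTop] fun t : ℝ => (t : ℂ) ^ d := by
  have hc : v (k + d) 0 / (d.factorial : ℂ) ≠ 0 :=
    div_ne_zero h (by exact_mod_cast d.factorial_ne_zero)
  have h1 : polyPart v (d + 1) k ~[atTop]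
      fun t : ℝ => v (k + d) 0 / (d.factorial : ℂ) * (t : ℂ) ^ d := by
    refine ((isLittleO_sum_pow (fun j => v (k + j) 0) d).const_mul_right hc).congr_left fun t => ?_
    simp only [Pi.sub_apply, polyPart, Finset.sum_range_succ]
    ring
  exact h1.isTheta.trans ((isTheta_refl _ _).const_mul_left hc)

/-- The polynomial at `k + 1` is the derivative of the one at `k`, and the Euler operator `t * d/dt
- d` annihilates the term of degree `d`; only lower degrees remain. -/
theorem mul_polyPart_sub (v : ℕ → ℝ → ℂ) (d k : ℕ) (t : ℝ) :
    t * polyPart v d (k + 1) t - d * polyPart v (d + 1) k t =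
      ∑ j ∈ Finset.range d, v (k + j) 0 * (j - d : ℂ) * (t : ℂ) ^ j / (j.factorial : ℂ) := by
  have h1 : (t : ℂ) * polyPart v d (k + 1) t =
      ∑ j ∈ Finset.range (d + 1), v (k + j) 0 * j * (t : ℂ) ^ j / (j.factorial : ℂ) := by
    rw [Finset.sum_range_succ', polyPart, Finset.mul_sum]
    simp only [Nat.cast_zero, mul_zero, zero_mul, zero_div, add_zero]
    refine Finset.sum_congr rfl fun j _ => ?_
    have : (j.factorial : ℂ) ≠ 0 := by exact_mod_cast j.factorial_ne_zero
    have : (j + 1 : ℂ) ≠ 0 := by exact_mod_cast j.succ_ne_zero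
    rw [Nat.factorial_succ, add_right_comm, add_assoc]
    push_cast
    field_simp
    ring
  rw [h1, polyPart, Finset.mul_sum, ← Finset.sum_sub_distrib, Finset.sum_range_succ]
  simp only [mul_assoc, mul_div_assoc]
  rw [sub_eq_zero.2, add_zero]
  · exact Finset.sum_congr rfl fun j _ => by ring
  · ring

/-- The logarithmic derivative of the polynomial part of the `k`-th coordinate. -/
noncomputable def logDerivPart (v : ℕ → ℝ → ℂ) (k : ℕ) (t : ℝ) : ℂ := v (k + 1) t / v k t

theorem logDerivPart_eq (h : IsJordanChain μ L v) {k d : ℕ} (hkd : k + d + 1 = L) (t : ℝ) :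
    logDerivPart v k t = polyPart v d (k + 1) t / polyPart v (d + 1) k t := by
  rw [logDerivPart, h.eq_exp_mul d (k + 1) (by omega), h.eq_exp_mul (d + 1) k (by omega),
    mul_div_mul_left _ _ (Complex.exp_ne_zero _)]

/-- The coefficient of `t ^ d` is the initial value of the last coordinate of the chain, which is
nonzero; hence the order is the same for all admissible initial values. -/
theorem isTheta (h : IsJordanChain μ L v) {k d : ℕ} (hkd : k + d + 1 = L) :
    (fun t => ‖v k t‖) =Θ[atTop] expMonomial (toLex (μ.re, d)) := by
  have h1 := (isTheta_polyPart v d k (h.ne_zero _ hkd)).norm_left.norm_right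
  have h2 := (isTheta_refl (fun t : ℝ => Real.exp (μ.re * t)) atTop).mul h1
  refine (EventuallyEq.trans_isTheta (EventuallyEq.of_eq (funext fun t => ?_)) h2).trans
    (EventuallyEq.isTheta ?_)
  · rw [h.eq_exp_mul (d + 1) k (by omega), norm_mul, Complex.norm_exp]
    simp
  · filter_upwards [eventually_ge_atTop 0] with t ht
    rw [norm_ofReal_pow, Real.norm_of_nonneg (by positivity)]
    rfl

theorem eventually_ne_zero (h : IsJordanChain μ L v) {k d : ℕ} (hkd : k + d + 1 = L) :
    ∀ᶠ t in atTop, v k t ≠ 0 := by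
  filter_upwards [(h.isTheta hkd).2.eq_zero_imp, eventually_gt_atTop 0] with t ht h0 hv
  exact (expMonomial_pos _ h0).ne' (ht (by simp [hv]))

/-- This is the expansion `d / t + O(t⁻²)`. The error term is needed for coordinates of equal
degree, whose leading parts cancel. -/
theorem isBigO_logDerivPart (h : IsJordanChain μ L v) {k d : ℕ} (hkd : k + d + 1 = L) :
    (fun t : ℝ => (t : ℂ) * (t * logDerivPart v k t - d)) =O[atTop] fun _ => (1 : ℂ) := by
  have h0 := isTheta_polyPart v d k (h.ne_zero _ hkd)
  have h1 : (fun t : ℝ => (t : ℂ) * (t * polyPart v d (k + 1) t - d * polyPart v (d + 1) k t))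
      =O[atTop] polyPart v (d + 1) k := by
    refine IsBigO.trans ?_ h0.2
    simp only [mul_polyPart_sub, Finset.mul_sum]
    refine IsBigO.fun_sum fun j hj => ?_
    have h2 : (fun t : ℝ => (t : ℂ) ^ (j + 1)) =O[atTop] fun t : ℝ => (t : ℂ) ^ d := by
      rcases (Nat.succ_le_of_lt (Finset.mem_range.1 hj)).eq_or_lt with h3 | h3
      · rw [← h3]
      · simpa using (isLittleO_ofReal_pow h3 1).isBigO
    refine (h2.const_mul_left (v (k + j) 0 * (j - d : ℂ) / (j.factorial : ℂ))).congr_left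
      fun t => ?_
    ring
  have h2 := h1.mul (isBigO_refl (fun t => (polyPart v (d + 1) k t)⁻¹) atTop)
  have hne : ∀ᶠ t in atTop, polyPart v (d + 1) k t ≠ 0 := by
    filter_upwards [h.eventually_ne_zero hkd] with t ht h3
    exact ht (by rw [h.eq_exp_mul (d + 1) k (by omega), h3, mul_zero])
  refine h2.congr' ?_ ?_
  · filter_upwards [hne] with t ht
    rw [h.logDerivPart_eq hkd]
    field_simp
  · filter_upwards [hne] with t ht
    exact mul_inv_cancel₀ ht

theorem logDerivPart_eq_zero (h : IsJordanChain μ L v) {k : ℕ} (hk : k + 1 = L) (t : ℝ) :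
    logDerivPart v k t = 0 := by
  rw [logDerivPart, h.eq_zero _ _ hk.ge, zero_div]

theorem im_logDerivPart (h : IsJordanChain μ L v) (hμ : μ.im = 0) (k : ℕ) (t : ℝ) :
    (logDerivPart v k t).im = 0 := by
  rw [logDerivPart, Complex.div_im, h.im_eq_zero hμ, h.im_eq_zero hμ]
  simp

theorem polyPart_mem_expPoly (v : ℕ → ℝ → ℂ) (d k : ℕ) :
    (fun t => (polyPart v d k t).re) ∈ expPoly ∧ (fun t => (polyPart v d k t).im) ∈ expPoly := by
  have hpow (j : ℕ) (c : ℝ) : (fun t : ℝ => c * t ^ j) ∈ expPoly :=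
    expPoly.mul_mem (const_mem_expPoly c) (expPoly.pow_mem id_mem_expPoly j)
  have hterm (j : ℕ) (t : ℝ) : v (k + j) 0 * (t : ℂ) ^ j / (j.factorial : ℂ) =
      v (k + j) 0 / (j.factorial : ℂ) * ((t ^ j : ℝ) : ℂ) := by
    push_cast; ring
  constructor
  · have : (fun t => (polyPart v d k t).re) = ∑ j ∈ Finset.range d,
        fun t : ℝ => (v (k + j) 0 / (j.factorial : ℂ)).re * t ^ j := by
      funext t
      rw [polyPart, Complex.re_sum, Finset.sum_apply]
      exact Finset.sum_congr rfl fun j _ => by rw [hterm, Complex.re_mul_ofReal]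
    rw [this]
    exact expPoly.sum_mem fun j _ => hpow j _
  · have : (fun t => (polyPart v d k t).im) = ∑ j ∈ Finset.range d,
        fun t : ℝ => (v (k + j) 0 / (j.factorial : ℂ)).im * t ^ j := by
      funext t
      rw [polyPart, Complex.im_sum, Finset.sum_apply]
      exact Finset.sum_congr rfl fun j _ => by rw [hterm, Complex.im_mul_ofReal]
    rw [this]
    exact expPoly.sum_mem fun j _ => hpow j _

/-- Conjugation cancels the oscillating factor `exp (i Im μ t)`, leaving the real exponent `2 Re μ`.
The imaginary part enters through products with `μ` in the acceleration. -/
theorem inner_mem_expPoly (h : IsJordanChain μ L v) (i j : ℕ) :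
    (fun t => inner ℝ (v i t) (v j t)) ∈ expPoly ∧
      (fun t => (starRingEnd ℂ (v i t) * v j t).im) ∈ expPoly := by
  obtain ⟨hri, hii⟩ := polyPart_mem_expPoly v L i
  obtain ⟨hrj, hij⟩ := polyPart_mem_expPoly v L j
  have he := exp_mem_expPoly (2 * μ.re)
  have key (t : ℝ) : starRingEnd ℂ (v i t) * v j t = (Real.exp (2 * μ.re * t) : ℂ) *
      (starRingEnd ℂ (polyPart v L i t) * polyPart v L j t) := by
    rw [h.eq_exp_mul L i (by omega), h.eq_exp_mul L j (by omega), map_mul, ← Complex.exp_conj,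
      mul_mul_mul_comm, ← Complex.exp_add, Complex.ofReal_exp]
    congr 2
    apply Complex.ext <;> simp
    ring
  constructor
  · refine (congrArg (· ∈ expPoly) ?_).mpr (expPoly.mul_mem he (expPoly.add_mem
      (expPoly.mul_mem hri hrj) (expPoly.mul_mem hii hij)))
    funext t
    have : inner ℝ (v i t) (v j t) = (starRingEnd ℂ (v i t) * v j t).re := by
      rw [Complex.inner, mul_comm]
    rw [this, key, Complex.re_ofReal_mul]
    simp
  · refine (congrArg (· ∈ expPoly) ?_).mpr (expPoly.mul_mem he (expPoly.sub_mem
      (expPoly.mul_mem hri hij) (expPoly.mul_mem hii hrj)))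
    funext t
    rw [key, Complex.im_ofReal_mul]
    simp
    ring

end IsJordanChain

/-! ### Pairwise area terms and their orders of growth -/

/-- The contribution, relative to `‖v‖ ^ 2 * ‖w‖ ^ 2`, of two complex coordinates `v`, `w` with
derivatives `p * v`, `q * w` to the Gram determinant of velocity and acceleration. -/
def ratioGap (p q : ℂ) : ℝ := (p.re - q.re) ^ 2 + p.im ^ 2 + q.im ^ 2

theorem ratioGap_nonneg (p q : ℂ) : 0 ≤ ratioGap p q := by
  unfold ratioGap; positivity

theorem ratioGap_eq_zero {p q : ℂ} : ratioGap p q = 0 ↔ p = q ∧ p.im = 0 := by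
  unfold ratioGap
  constructor
  · intro h
    have h1 : (p.re - q.re) ^ 2 = 0 := by
      nlinarith [sq_nonneg (p.re - q.re), sq_nonneg p.im, sq_nonneg q.im]
    have h2 : p.im ^ 2 = 0 := by
      nlinarith [sq_nonneg (p.re - q.re), sq_nonneg p.im, sq_nonneg q.im]
    have h3 : q.im ^ 2 = 0 := by
      nlinarith [sq_nonneg (p.re - q.re), sq_nonneg p.im, sq_nonneg q.im]
    rw [sq_eq_zero_iff] at h1 h2 h3
    exact ⟨Complex.ext (sub_eq_zero.1 h1) (h2.trans h3.symm), h2⟩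
  · rintro ⟨rfl, h⟩
    simp [h]

/-- The real inner product of `v` with `p * v` sees only `Re p`, so the left side is `‖v‖² ‖w‖²`
times `|p|² + |q|² - 2 Re p Re q`. -/
theorem inner_sq_expand (v w p q : ℂ) :
    inner ℝ v v * inner ℝ (q * w) (q * w) + inner ℝ w w * inner ℝ (p * v) (p * v) -
      2 * (inner ℝ v (p * v) * inner ℝ w (q * w)) = ‖v‖ ^ 2 * ‖w‖ ^ 2 * ratioGap p q := by
  simp only [← Complex.normSq_eq_norm_sq, Complex.normSq_apply, Complex.inner, Complex.mul_re,
    Complex.mul_im, Complex.conj_re, Complex.conj_im, ratioGap]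
  ring

/-- Asymptotic data of the coordinates `v x` of a velocity vector, with logarithmic derivatives
`μ x + η x t`. -/
structure IsGrowthData {K : Type*} (μ : K → ℂ) (d : K → ℕ) (v η : K → ℝ → ℂ) : Prop where
  isTheta : ∀ x, (fun t => ‖v x t‖) =Θ[atTop] expMonomial (toLex ((μ x).re, d x))
  isBigO : ∀ x, (fun t : ℝ => (t : ℂ) * (t * η x t - d x)) =O[atTop] fun _ => (1 : ℂ)
  eq_zero : ∀ x, d x = 0 → ∀ t, η x t = 0
  im_eq_zero : ∀ x, (μ x).im = 0 → ∀ t, (η x t).im = 0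

open scoped Classical in
/-- The order of decay of the relative area spanned by two coordinates. -/
noncomputable def gapScale (p q : ℂ) (m n : ℕ) (t : ℝ) : ℝ :=
  if ratioGap p q ≠ 0 then 1
  else if m ≠ n then (t ^ 2)⁻¹
  else if m ≠ 0 then (t ^ 4)⁻¹ else 0

theorem isTheta_one_of_tendsto {f : ℝ → ℝ} {c : ℝ} (hc : c ≠ 0) (hf : Tendsto f atTop (𝓝 c)) :
    f =Θ[atTop] fun _ => (1 : ℝ) :=
  ((isEquivalent_const_iff_tendsto hc).2 hf).isTheta.trans (isTheta_const_const hc one_ne_zero)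

namespace IsGrowthData

variable {K : Type*} {μ : K → ℂ} {d : K → ℕ} {v η : K → ℝ → ℂ}

theorem tendsto_mul (h : IsGrowthData μ d v η) (x : K) :
    Tendsto (fun t : ℝ => t * η x t) atTop (𝓝 (d x)) := by
  have h1 : Tendsto (fun t : ℝ => ((t : ℂ))⁻¹) atTop (𝓝 0) :=
    tendsto_inv₀_cobounded.comp (RCLike.tendsto_ofReal_atTop_cobounded ℂ)
  have h2 := (isBigO_refl (fun t : ℝ => ((t : ℂ))⁻¹) atTop).mul (h.isBigO x)
  simp only [mul_one] at h2
  have h3 := h2.trans_tendsto h1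
  have h4 := h3.add_const (d x : ℂ)
  rw [zero_add] at h4
  refine h4.congr' ?_
  filter_upwards [eventually_gt_atTop 0] with t ht
  have : (t : ℂ) ≠ 0 := by exact_mod_cast ht.ne'
  field_simp
  ring

theorem tendsto_zero (h : IsGrowthData μ d v η) (x : K) :
    Tendsto (η x) atTop (𝓝 0) := by
  have h1 : Tendsto (fun t : ℝ => ((t : ℂ))⁻¹) atTop (𝓝 0) :=
    tendsto_inv₀_cobounded.comp (RCLike.tendsto_ofReal_atTop_cobounded ℂ)
  have h2 := h1.mul (h.tendsto_mul x)
  rw [zero_mul] at h2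
  refine h2.congr' ?_
  filter_upwards [eventually_gt_atTop 0] with t ht
  have : (t : ℂ) ≠ 0 := by exact_mod_cast ht.ne'
  field_simp

theorem tendsto_ratioGap (h : IsGrowthData μ d v η) (x y : K) :
    Tendsto (fun t => ratioGap (μ x + η x t) (μ y + η y t)) atTop (𝓝 (ratioGap (μ x) (μ y))) := by
  have hx := (h.tendsto_zero x).const_add (μ x)
  have hy := (h.tendsto_zero y).const_add (μ y)
  rw [add_zero] at hx hy
  have hre (f : ℝ → ℂ) (c : ℂ) (hf : Tendsto f atTop (𝓝 c)) :
      Tendsto (fun t => (f t).re) atTop (𝓝 c.re) := (Complex.continuous_re.tendsto c).comp hf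
  have him (f : ℝ → ℂ) (c : ℂ) (hf : Tendsto f atTop (𝓝 c)) :
      Tendsto (fun t => (f t).im) atTop (𝓝 c.im) := (Complex.continuous_im.tendsto c).comp hf
  exact ((((hre _ _ hx).sub (hre _ _ hy)).pow 2).add ((him _ _ hx).pow 2)).add ((him _ _ hy).pow 2)

theorem ratioGap_of_eq (h : IsGrowthData μ d v η) {x y : K} (hxy : ratioGap (μ x) (μ y) = 0)
    (t : ℝ) : ratioGap (μ x + η x t) (μ y + η y t) = ((η x t).re - (η y t).re) ^ 2 := by
  obtain ⟨h1, h2⟩ := ratioGap_eq_zero.1 hxy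
  have h3 := h2
  rw [h1] at h3
  simp only [ratioGap, Complex.add_re, Complex.add_im, h3, h.im_eq_zero x h2 t,
    h.im_eq_zero y h3 t, h1]
  ring

theorem isTheta_ratioGap_of_ne (h : IsGrowthData μ d v η) {x y : K}
    (hxy : ratioGap (μ x) (μ y) ≠ 0) :
    (fun t => ratioGap (μ x + η x t) (μ y + η y t)) =Θ[atTop] fun _ => (1 : ℝ) :=
  isTheta_one_of_tendsto hxy (h.tendsto_ratioGap x y)

/-- The eigenvalues are equal and real, so the gap is the square of `(d x - d y) / t + O(t⁻²)`. -/
theorem isTheta_ratioGap_of_degree_ne (h : IsGrowthData μ d v η) {x y : K}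
    (hxy : ratioGap (μ x) (μ y) = 0) (hd : d x ≠ d y) :
    (fun t => ratioGap (μ x + η x t) (μ y + η y t)) =Θ[atTop] fun t : ℝ => (t ^ 2)⁻¹ := by
  have hre : Tendsto (fun t : ℝ => ((t * η x t - t * η y t : ℂ)).re) atTop
      (𝓝 ((d x - d y : ℂ)).re) :=
    (Complex.continuous_re.tendsto _).comp ((h.tendsto_mul x).sub (h.tendsto_mul y))
  have hne : ((d x - d y : ℂ)).re ^ 2 ≠ 0 := by
    have : (d x : ℝ) - d y ≠ 0 := sub_ne_zero.2 (by exact_mod_cast hd)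
    simpa using this
  have h1 := (isTheta_one_of_tendsto hne (hre.pow 2)).mul (isTheta_refl (fun t : ℝ => (t ^ 2)⁻¹) atTop)
  simp only [one_mul] at h1
  refine EventuallyEq.trans_isTheta ?_ h1
  filter_upwards [eventually_gt_atTop 0] with t ht
  rw [h.ratioGap_of_eq hxy]
  simp only [Complex.sub_re, Complex.re_ofReal_mul]
  field_simp

theorem isBigO_ratioGap_of_degree_eq (h : IsGrowthData μ d v η) {x y : K}
    (hxy : ratioGap (μ x) (μ y) = 0) (hd : d x = d y) :
    (fun t => ratioGap (μ x + η x t) (μ y + η y t)) =O[atTop] fun t : ℝ => (t ^ 4)⁻¹ := by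
  have h0 := ((h.isBigO x).sub (h.isBigO y)).norm_norm
  have h1 : (fun t : ℝ => t ^ 2 * ((η x t).re - (η y t).re)) =O[atTop] fun _ => (1 : ℝ) := by
    refine (IsBigO.of_bound 1 (Eventually.of_forall fun t => ?_)).trans
      (h0.trans (IsBigO.of_bound 1 (Eventually.of_forall fun t => by simp)))
    have : t ^ 2 * ((η x t).re - (η y t).re) =
        ((t : ℂ) * (t * η x t - d x) - (t : ℂ) * (t * η y t - d y)).re := by
      rw [hd]
      simp
      ring
    rw [this, one_mul, norm_norm]
    exact Complex.abs_re_le_norm _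
  have h2 := (h1.pow 2).mul (isBigO_refl (fun t : ℝ => (t ^ 4)⁻¹) atTop)
  simp only [one_pow, one_mul] at h2
  refine h2.congr' ?_ EventuallyEq.rfl
  filter_upwards [eventually_gt_atTop 0] with t ht
  rw [h.ratioGap_of_eq hxy]
  field_simp

theorem ratioGap_eq_zero_of_degree_zero (h : IsGrowthData μ d v η) {x y : K}
    (hxy : ratioGap (μ x) (μ y) = 0) (hx : d x = 0) (hy : d y = 0) (t : ℝ) :
    ratioGap (μ x + η x t) (μ y + η y t) = 0 := by
  rw [h.ratioGap_of_eq hxy, h.eq_zero x hx, h.eq_zero y hy, sub_self, sq, zero_mul]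

/-- Only an upper bound can hold: for equal real eigenvalues and equal degrees the gap can vanish,
for instance when `x = y`. -/
theorem isBigO_gapScale (h : IsGrowthData μ d v η) (x y : K) :
    (fun t => ratioGap (μ x + η x t) (μ y + η y t)) =O[atTop]
      gapScale (μ x) (μ y) (d x) (d y) := by
  unfold gapScale
  by_cases hxy : ratioGap (μ x) (μ y) = 0
  · by_cases hd : d x = d y
    · by_cases h0 : d x = 0
      · simp only [h.ratioGap_eq_zero_of_degree_zero hxy h0 (hd ▸ h0)]
        exact isBigO_zero _ _
      · simpa [hxy, ← hd, h0] using h.isBigO_ratioGap_of_degree_eq hxy hd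
    · simpa [hxy, hd] using (h.isTheta_ratioGap_of_degree_ne hxy hd).1
  · simpa [hxy] using (h.isTheta_ratioGap_of_ne hxy).1

theorem isTheta_mul (h : IsGrowthData μ d v η) (x y : K) :
    (fun t => ‖v x t‖ ^ 2 * ‖v y t‖ ^ 2) =Θ[atTop] fun t =>
      expMonomial (toLex ((μ x).re, d x)) t ^ 2 * expMonomial (toLex ((μ y).re, d y)) t ^ 2 :=
  ((h.isTheta x).pow 2).mul ((h.isTheta y).pow 2)

variable [Fintype K]

/-- Twice the squared area spanned by velocity and acceleration. -/
noncomputable def areaSum (μ : K → ℂ) (v η : K → ℝ → ℂ) (t : ℝ) : ℝ :=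
  ∑ x, ∑ y, ‖v x t‖ ^ 2 * ‖v y t‖ ^ 2 * ratioGap (μ x + η x t) (μ y + η y t)

theorem term_le_areaSum (μ : K → ℂ) (v η : K → ℝ → ℂ) (x y : K) (t : ℝ) :
    ‖v x t‖ ^ 2 * ‖v y t‖ ^ 2 * ratioGap (μ x + η x t) (μ y + η y t) ≤ areaSum μ v η t := by
  have h0 (x y : K) :
      0 ≤ ‖v x t‖ ^ 2 * ‖v y t‖ ^ 2 * ratioGap (μ x + η x t) (μ y + η y t) :=
    mul_nonneg (by positivity) (ratioGap_nonneg _ _)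
  exact (Finset.single_le_sum (fun y _ => h0 x y) (Finset.mem_univ y)).trans
    (Finset.single_le_sum (f := fun x => ∑ y, ‖v x t‖ ^ 2 * ‖v y t‖ ^ 2 *
      ratioGap (μ x + η x t) (μ y + η y t)) (fun x _ => Finset.sum_nonneg fun y _ => h0 x y)
      (Finset.mem_univ x))

theorem scale_isBigO_areaSum_of_isTheta (h : IsGrowthData μ d v η) {x y : K} {σ : ℝ → ℝ}
    (hσ : (fun t => ratioGap (μ x + η x t) (μ y + η y t)) =Θ[atTop] σ) :
    (fun t => expMonomial (toLex ((μ x).re, d x)) t ^ 2 *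
      expMonomial (toLex ((μ y).re, d y)) t ^ 2 * σ t) =O[atTop] areaSum μ v η := by
  refine ((h.isTheta_mul x y).mul hσ).2.trans (IsBigO.of_bound 1 (Eventually.of_forall fun t => ?_))
  have h1 := term_le_areaSum μ v η x y t
  have h2 : 0 ≤ ‖v x t‖ ^ 2 * ‖v y t‖ ^ 2 * ratioGap (μ x + η x t) (μ y + η y t) :=
    mul_nonneg (by positivity) (ratioGap_nonneg _ _)
  rw [one_mul, Real.norm_of_nonneg h2, Real.norm_of_nonneg (h2.trans h1)]
  exact h1

/-- When the gap has an exact order, the pair's own term suffices. For equal real eigenvalues and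
equal positive degree `d`, the pair of `x` with a coordinate of degree `d - 1` is used instead. -/
theorem scale_isBigO_areaSum (h : IsGrowthData μ d v η)
    (hd : ∀ x, d x ≠ 0 → ∃ y, μ y = μ x ∧ d x = d y + 1) (x y : K) :
    (fun t => expMonomial (toLex ((μ x).re, d x)) t ^ 2 *
      expMonomial (toLex ((μ y).re, d y)) t ^ 2 * gapScale (μ x) (μ y) (d x) (d y) t)
      =O[atTop] areaSum μ v η := by
  by_cases hxy : ratioGap (μ x) (μ y) = 0
  · by_cases hxd : d x = d y
    · by_cases h0 : d x = 0
      · have : gapScale (μ x) (μ y) (d x) (d y) = fun _ => 0 := by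
          funext t; simp [gapScale, hxy, ← hxd, h0]
        simp only [this, mul_zero]
        exact isBigO_zero _ _
      · obtain ⟨z, hz, hdz⟩ := hd x h0
        obtain ⟨hxy', him⟩ := ratioGap_eq_zero.1 hxy
        have hxz : ratioGap (μ x) (μ z) = 0 := ratioGap_eq_zero.2 ⟨hz.symm, him⟩
        have h1 := h.scale_isBigO_areaSum_of_isTheta
          (h.isTheta_ratioGap_of_degree_ne hxz (by omega))
        -- Apart from the common exponential, both scales are `t ^ (4 d - 4)`: `2d + 2(d - 1) - 2`
        -- on one side, `2d + 2d - 4` on the other.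
        refine h1.congr' ?_ EventuallyEq.rfl
        filter_upwards [eventually_gt_atTop 0] with t ht
        have hg : gapScale (μ x) (μ y) (d x) (d y) t = (t ^ 4)⁻¹ := by
          simp [gapScale, hxy, ← hxd, h0]
        rw [hg, ← hxy', ← hxd, hz]
        simp only [expMonomial, ofLex_toLex, hdz]
        field_simp
        ring
    · have : gapScale (μ x) (μ y) (d x) (d y) = fun t => (t ^ 2)⁻¹ := by
        funext t; simp [gapScale, hxy, hxd]
      rw [this]
      exact h.scale_isBigO_areaSum_of_isTheta (h.isTheta_ratioGap_of_degree_ne hxy hxd)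
  · have : gapScale (μ x) (μ y) (d x) (d y) = fun t => 1 := by
      funext t; simp [gapScale, hxy]
    rw [this]
    exact h.scale_isBigO_areaSum_of_isTheta (h.isTheta_ratioGap_of_ne hxy)

theorem areaSum_isBigO_areaSum {v' η' : K → ℝ → ℂ} (h : IsGrowthData μ d v η)
    (h' : IsGrowthData μ d v' η') (hd : ∀ x, d x ≠ 0 → ∃ y, μ y = μ x ∧ d x = d y + 1) :
    areaSum μ v η =O[atTop] areaSum μ v' η' := by
  refine IsBigO.fun_sum fun x _ => IsBigO.fun_sum fun y _ => ?_
  exact ((h.isTheta_mul x y).1.mul (h.isBigO_gapScale x y)).trans (h'.scale_isBigO_areaSum hd x y)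

theorem sum_sq_isBigO_sum_sq {v' η' : K → ℝ → ℂ} (h : IsGrowthData μ d v η)
    (h' : IsGrowthData μ d v' η') :
    (fun t => ∑ x, ‖v x t‖ ^ 2) =O[atTop] fun t => ∑ x, ‖v' x t‖ ^ 2 := by
  refine IsBigO.fun_sum fun x _ => (((h.isTheta x).trans (h'.isTheta x).symm).pow 2).1.trans
    (IsBigO.of_bound 1 (Eventually.of_forall fun t => ?_))
  have h1 : ‖v' x t‖ ^ 2 ≤ ∑ x, ‖v' x t‖ ^ 2 :=
    Finset.single_le_sum (f := fun x => ‖v' x t‖ ^ 2) (fun _ _ => by positivity)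
      (Finset.mem_univ x)
  rw [one_mul, Real.norm_of_nonneg (by positivity), Real.norm_of_nonneg (by positivity)]
  exact h1

end IsGrowthData

/-! ### Complex coordinates of a real Jordan block -/

namespace RealJordanBlock

/-- The number of complex coordinates of a block. -/
def len : RealJordanBlock → ℕ
  | real p _ _ => p
  | complex m _ _ _ _ => m

/-- The eigenvalue of a block acting on its complex coordinates. -/
def eig : RealJordanBlock → ℂ
  | real _ _ l => l
  | complex _ _ a b _ => ⟨a, -b⟩

/-- The complex coordinates of a vector with respect to a block, extended by zero. -/
noncomputable def coord : (B : RealJordanBlock) → (Fin B.size → ℝ) → ℕ → ℂ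
  | real p _ _, x, k => if h : k < p then ((x ⟨k, h⟩ : ℝ) : ℂ) else 0
  | complex m _ _ _ _, x, k =>
    if h : k < m then ((x (finProdFinEquiv (⟨k, h⟩, 0)) : ℝ) : ℂ) +
      ((x (finProdFinEquiv (⟨k, h⟩, 1)) : ℝ) : ℂ) * Complex.I else 0

theorem coord_of_len_le (B : RealJordanBlock) (x : Fin B.size → ℝ) {k : ℕ} (hk : B.len ≤ k) :
    B.coord x k = 0 := by
  cases B <;> exact dif_neg (not_lt.2 hk)

theorem coord_ne_zero (B : RealJordanBlock) (x : Fin B.size → ℝ) (hx : ∀ i, x i ≠ 0) {k : ℕ}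
    (hk : k < B.len) : B.coord x k ≠ 0 := by
  cases B with
  | real p hp l =>
    exact ne_of_eq_of_ne (dif_pos hk) (Complex.ofReal_ne_zero.2 (hx ⟨k, hk⟩))
  | complex m hm a b hb =>
    intro h
    have h1 := congrArg Complex.re ((dif_pos hk).symm.trans h)
    simp only [Complex.add_re, Complex.ofReal_re, Complex.re_ofReal_mul, Complex.I_re, mul_zero,
      add_zero, Complex.zero_re] at h1
    exact hx _ h1

theorem coord_im_eq_zero (B : RealJordanBlock) (hB : B.eig.im = 0) (x : Fin B.size → ℝ) (k : ℕ) :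
    (B.coord x k).im = 0 := by
  cases B with
  | real p hp l =>
    rw [coord]
    split_ifs <;> simp
  | complex m hm a b hb => exact absurd (neg_eq_zero.1 hB) hb.ne'

theorem hasDerivAt_coord (B : RealJordanBlock) {x : ℝ → Fin B.size → ℝ} {x' : Fin B.size → ℝ}
    {t : ℝ} (h : ∀ i, HasDerivAt (fun s => x s i) (x' i) t) (k : ℕ) :
    HasDerivAt (fun s => B.coord (x s) k) (B.coord x' k) t := by
  cases B with
  | real p hp l =>
    simp only [coord]
    split_ifs
    · exact (h _).ofReal_comp
    · exact hasDerivAt_const _ _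
  | complex m hm a b hb =>
    simp only [coord]
    split_ifs
    · exact (h _).ofReal_comp.add ((h _).ofReal_comp.mul_const _)
    · exact hasDerivAt_const _ _

theorem sum_mul_eq_sum_inner (B : RealJordanBlock) (x y : Fin B.size → ℝ) :
    ∑ i, x i * y i = ∑ k ∈ Finset.range B.len, inner ℝ (B.coord x k) (B.coord y k) := by
  cases B with
  | real p hp l =>
    rw [len, Finset.sum_range]
    refine Finset.sum_congr rfl fun i _ => ?_
    have h (z : Fin p → ℝ) : coord (real p hp l) z i = (z i : ℂ) := dif_pos i.2
    refine Eq.trans ?_ (congrArg₂ (inner ℝ) (h x) (h y)).symm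
    simp [Complex.inner, mul_comm]
  | complex m hm a b hb =>
    rw [len, Finset.sum_range]
    have h : ∑ i : Fin (m * 2), x i * y i = ∑ z : Fin m × Fin 2,
        x (finProdFinEquiv z) * y (finProdFinEquiv z) :=
      (Equiv.sum_comp finProdFinEquiv fun i : Fin (m * 2) => x i * y i).symm
    refine h.trans ?_
    rw [Fintype.sum_prod_type]
    refine Finset.sum_congr rfl fun i _ => ?_
    rw [Fin.sum_univ_two]
    simp [coord, Complex.inner]
    ring

theorem sum_ite_succ_eq {p : ℕ} (f : Fin p → ℝ) (i : ℕ) :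
    ∑ j : Fin p, (if i + 1 = (j : ℕ) then f j else 0) =
      if h : i + 1 < p then f ⟨i + 1, h⟩ else 0 := by
  split_ifs with h
  · rw [Finset.sum_eq_single ⟨i + 1, h⟩]
    · simp
    · intro j _ hj
      exact if_neg fun e => hj (Fin.ext e.symm)
    · simp
  · exact Finset.sum_eq_zero fun j _ => if_neg (by omega)

theorem realMatrix_mulVec (p : ℕ) (l : ℝ) (x : Fin p → ℝ) (i : Fin p) :
    (realMatrix p l).mulVec x i = l * x i + if h : i.1 + 1 < p then x ⟨i.1 + 1, h⟩ else 0 := by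
  rw [← sum_ite_succ_eq, Matrix.mulVec, dotProduct]
  have h1 : l * x i = ∑ j, if i = j then l * x j else 0 := by simp
  rw [h1, ← Finset.sum_add_distrib]
  refine Finset.sum_congr rfl fun j _ => ?_
  rw [realMatrix, Matrix.of_apply]
  by_cases h : i = j
  · subst h; simp
  · simp [h]

theorem complexMatrix_mulVec (m : ℕ) (a b : ℝ) (x : Fin (m * 2) → ℝ) (i : Fin m) (s : Fin 2) :
    (complexMatrix m a b).mulVec x (finProdFinEquiv (i, s)) =
      (!![a, b; -b, a] : Matrix (Fin 2) (Fin 2) ℝ) s 0 * x (finProdFinEquiv (i, 0)) +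
      (!![a, b; -b, a] : Matrix (Fin 2) (Fin 2) ℝ) s 1 * x (finProdFinEquiv (i, 1)) +
      if h : i.1 + 1 < m then x (finProdFinEquiv (⟨i.1 + 1, h⟩, s)) else 0 := by
  rw [← sum_ite_succ_eq fun j => x (finProdFinEquiv (j, s)), Matrix.mulVec, dotProduct,
    ← Equiv.sum_comp finProdFinEquiv, Fintype.sum_prod_type]
  have h1 : (!![a, b; -b, a] : Matrix (Fin 2) (Fin 2) ℝ) s 0 * x (finProdFinEquiv (i, 0)) +
      (!![a, b; -b, a] : Matrix (Fin 2) (Fin 2) ℝ) s 1 * x (finProdFinEquiv (i, 1)) =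
      ∑ j : Fin m, if i = j then
        (!![a, b; -b, a] : Matrix (Fin 2) (Fin 2) ℝ) s 0 * x (finProdFinEquiv (j, 0)) +
        (!![a, b; -b, a] : Matrix (Fin 2) (Fin 2) ℝ) s 1 * x (finProdFinEquiv (j, 1)) else 0 := by
    simp
  rw [h1, ← Finset.sum_add_distrib]
  refine Finset.sum_congr rfl fun j _ => ?_
  rw [Fin.sum_univ_two]
  simp only [complexMatrix, Matrix.reindex_apply, Matrix.submatrix_apply,
    Equiv.symm_apply_apply, Matrix.of_apply]
  by_cases h : i = j
  · subst h; simp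
  · by_cases h2 : i.1 + 1 = j
    · obtain rfl | rfl : s = 0 ∨ s = 1 := by fin_cases s <;> simp
      all_goals simp [h, h2]
    · simp [h, h2]

/-- On `x + i y` the block `!![a, b; -b, a]` acts as multiplication by `a - b i`, whence the sign in
`eig`. -/
theorem coord_mulVec (B : RealJordanBlock) (x : Fin B.size → ℝ) (k : ℕ) :
    B.coord (B.toMatrix.mulVec x) k = B.eig * B.coord x k + B.coord x (k + 1) := by
  by_cases hk : k < B.len
  swap
  · rw [B.coord_of_len_le _ (not_lt.1 hk), B.coord_of_len_le _ (not_lt.1 hk),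
      B.coord_of_len_le _ (by omega)]
    simp
  cases B with
  | real p hp l =>
    have hk' : k < p := hk
    have h := realMatrix_mulVec p l x ⟨k, hk⟩
    simp only [coord, eig, dif_pos hk', toMatrix]
    refine (congrArg Complex.ofReal h).trans ?_
    split_ifs <;> push_cast <;> rfl
  | complex m hm a b hb =>
    have hk' : k < m := hk
    have h0 := complexMatrix_mulVec m a b x ⟨k, hk⟩ 0
    have h1 := complexMatrix_mulVec m a b x ⟨k, hk⟩ 1
    simp only [coord, eig, dif_pos hk', toMatrix]
    refine (congrArg₂ (fun u v : ℝ => (u : ℂ) + v * Complex.I) h0 h1).trans ?_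
    split_ifs <;> apply Complex.ext <;> simp <;> ring

/-- The number of complex coordinates of a velocity vector which are not identically zero. -/
noncomputable def velLen (B : RealJordanBlock) : ℕ :=
  open scoped Classical in if B.eig = 0 then B.len - 1 else B.len

theorem velLen_le_len (B : RealJordanBlock) : B.velLen ≤ B.len := by
  unfold velLen; split_ifs <;> omega

/-- The velocity of a trajectory of a block with nonzero initial coordinates is a Jordan chain. -/
theorem isJordanChain_velocity (B : RealJordanBlock) {x : ℝ → Fin B.size → ℝ}
    (hx : ∀ i t, HasDerivAt (fun s => x s i) (B.toMatrix.mulVec (x t) i) t)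
    (h0 : ∀ i, x 0 i ≠ 0) :
    IsJordanChain B.eig B.velLen fun k t => B.coord (B.toMatrix.mulVec (x t)) k where
  hasDerivAt k t := by
    have h (j : ℕ) := B.hasDerivAt_coord (fun i => hx i t) j
    simp only [coord_mulVec] at h ⊢
    exact ((h k).const_mul _).add (h (k + 1))
  eq_zero k t hk := by
    rw [coord_mulVec]
    unfold velLen at hk
    split_ifs at hk with he
    · rw [he, B.coord_of_len_le _ (by omega : B.len ≤ k + 1), zero_mul, add_zero]
    · rw [B.coord_of_len_le _ hk, B.coord_of_len_le _ (by omega : B.len ≤ k + 1), mul_zero, add_zero]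
  ne_zero k hk := by
    simp only [coord_mulVec]
    unfold velLen at hk
    split_ifs at hk with he
    -- For eigenvalue `0` the velocity is the position shifted by one, so its last nonzero
    -- coordinate is the last coordinate of `x`.
    · rw [he, zero_mul, zero_add]
      exact B.coord_ne_zero _ h0 (by omega)
    · rw [B.coord_of_len_le _ hk.ge, add_zero]
      exact mul_ne_zero he (B.coord_ne_zero _ h0 (by omega))
  im_eq_zero hB k t := B.coord_im_eq_zero hB _ k

end RealJordanBlock

/-! ### The Gram determinant of a family of chains -/

namespace IsJordanChain

variable {ι : Type*} {μ : ι → ℂ} {L : ι → ℕ} {v : ι → ℕ → ℝ → ℂ}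

/-- The derivative of a family of Jordan chains. -/
def accel (μ : ι → ℂ) (v : ι → ℕ → ℝ → ℂ) (i : ι) (k : ℕ) (t : ℝ) : ℂ :=
  μ i * v i k t + v i (k + 1) t

theorem isGrowthData (h : ∀ i, IsJordanChain (μ i) (L i) (v i)) :
    IsGrowthData (K := Σ i, Fin (L i)) (fun x => μ x.1) (fun x => L x.1 - 1 - x.2)
      (fun x => v x.1 x.2) (fun x => logDerivPart (v x.1) x.2) where
  isTheta x := (h x.1).isTheta (by omega)
  isBigO x := (h x.1).isBigO_logDerivPart (by omega)
  eq_zero x hx := (h x.1).logDerivPart_eq_zero (by omega)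
  im_eq_zero x hx := (h x.1).im_logDerivPart hx _

theorem exists_degree_succ (μ : ι → ℂ) (L : ι → ℕ) (x : Σ i, Fin (L i))
    (hx : L x.1 - 1 - x.2 ≠ 0) :
    ∃ y : Σ i, Fin (L i), μ y.1 = μ x.1 ∧ L x.1 - 1 - x.2 = L y.1 - 1 - y.2 + 1 :=
  ⟨⟨x.1, ⟨x.2 + 1, by omega⟩⟩, rfl, by simp only; omega⟩

variable [Fintype ι]

/-- The sum of the coordinatewise real inner products of two families of curves. -/
noncomputable def dot (L : ι → ℕ) (v w : ι → ℕ → ℝ → ℂ) (t : ℝ) : ℝ :=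
  ∑ i, ∑ k ∈ Finset.range (L i), inner ℝ (v i k t) (w i k t)

/-- The Gram determinant of a family of Jordan chains and its derivative. -/
noncomputable def gram (μ : ι → ℂ) (L : ι → ℕ) (v : ι → ℕ → ℝ → ℂ) (t : ℝ) : ℝ :=
  dot L v v t * dot L (accel μ v) (accel μ v) t - dot L v (accel μ v) t ^ 2

theorem dot_mem_expPoly {v w : ι → ℕ → ℝ → ℂ}
    (h : ∀ i k, (fun t => inner ℝ (v i k t) (w i k t)) ∈ expPoly) : dot L v w ∈ expPoly := by
  have : dot L v w = ∑ i, ∑ k ∈ Finset.range (L i), fun t => inner ℝ (v i k t) (w i k t) := by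
    funext t
    simp [dot, Finset.sum_apply]
  rw [this]
  exact expPoly.sum_mem fun i _ => expPoly.sum_mem fun k _ => h i k

theorem dot_self_mem_expPoly (h : ∀ i, IsJordanChain (μ i) (L i) (v i)) :
    dot L v v ∈ expPoly :=
  dot_mem_expPoly fun i k => ((h i).inner_mem_expPoly k k).1

theorem dot_accel_mem_expPoly (h : ∀ i, IsJordanChain (μ i) (L i) (v i)) :
    dot L v (accel μ v) ∈ expPoly := by
  refine dot_mem_expPoly fun i k => ?_
  obtain ⟨h1, h2⟩ := (h i).inner_mem_expPoly k k
  obtain ⟨h3, _⟩ := (h i).inner_mem_expPoly k (k + 1)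
  refine (congrArg (· ∈ expPoly) ?_).mpr (expPoly.add_mem (expPoly.sub_mem
    (expPoly.mul_mem (const_mem_expPoly (μ i).re) h1)
    (expPoly.mul_mem (const_mem_expPoly (μ i).im) h2)) h3)
  funext t
  simp only [Pi.add_apply, Pi.sub_apply, Pi.mul_apply, accel, Complex.inner, Complex.mul_re,
    Complex.mul_im, Complex.add_re, Complex.add_im, Complex.conj_re, Complex.conj_im]
  ring

theorem dot_accel_accel_mem_expPoly (h : ∀ i, IsJordanChain (μ i) (L i) (v i)) :
    dot L (accel μ v) (accel μ v) ∈ expPoly := by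
  refine dot_mem_expPoly fun i k => ?_
  obtain ⟨h1, _⟩ := (h i).inner_mem_expPoly k k
  obtain ⟨h3, h4⟩ := (h i).inner_mem_expPoly k (k + 1)
  obtain ⟨h5, _⟩ := (h i).inner_mem_expPoly (k + 1) (k + 1)
  refine (congrArg (· ∈ expPoly) ?_).mpr (expPoly.add_mem (expPoly.add_mem
    (expPoly.mul_mem (const_mem_expPoly ((μ i).re ^ 2 + (μ i).im ^ 2)) h1) h5)
    (expPoly.mul_mem (const_mem_expPoly 2) (expPoly.add_mem
      (expPoly.mul_mem (const_mem_expPoly (μ i).re) h3)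
      (expPoly.mul_mem (const_mem_expPoly (μ i).im) h4))))
  funext t
  simp only [Pi.add_apply, Pi.mul_apply, accel, Complex.inner, Complex.mul_re,
    Complex.mul_im, Complex.add_re, Complex.add_im, Complex.conj_re, Complex.conj_im]
  ring

theorem gram_mem_expPoly (h : ∀ i, IsJordanChain (μ i) (L i) (v i)) : gram μ L v ∈ expPoly :=
  expPoly.sub_mem (expPoly.mul_mem (dot_self_mem_expPoly h) (dot_accel_accel_mem_expPoly h))
    (expPoly.pow_mem (dot_accel_mem_expPoly h) 2)

theorem dot_eq_sum_sigma (v w : ι → ℕ → ℝ → ℂ) (t : ℝ) :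
    dot L v w t = ∑ x : Σ i, Fin (L i), inner ℝ (v x.1 x.2 t) (w x.1 x.2 t) := by
  rw [dot, Fintype.sum_sigma]
  exact Finset.sum_congr rfl fun i _ => Finset.sum_range _

theorem dot_self_eq (v : ι → ℕ → ℝ → ℂ) (t : ℝ) :
    dot L v v t = ∑ x : Σ i, Fin (L i), ‖v x.1 x.2 t‖ ^ 2 := by
  rw [dot_eq_sum_sigma]
  exact Finset.sum_congr rfl fun _ _ => real_inner_self_eq_norm_sq _

theorem two_mul_gram {K : Type*} [Fintype K] (a b c : K → ℝ) :
    2 * ((∑ x, a x) * (∑ x, b x) - (∑ x, c x) ^ 2) =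
      ∑ x, ∑ y, (a x * b y + a y * b x - 2 * (c x * c y)) := by
  simp only [Finset.sum_sub_distrib, Finset.sum_add_distrib, ← Finset.mul_sum, ← Finset.sum_mul]
  ring

/-- The identity is only eventual: logarithmic derivatives require nonvanishing coordinates, and the
polynomial factors may have zeros at small times. -/
theorem two_mul_gram_eventuallyEq (h : ∀ i, IsJordanChain (μ i) (L i) (v i)) :
    (fun t => 2 * gram μ L v t) =ᶠ[atTop]
      IsGrowthData.areaSum (K := Σ i, Fin (L i)) (fun x => μ x.1)
      (fun x => v x.1 x.2) (fun x => logDerivPart (v x.1) x.2) := by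
  have hne : ∀ᶠ t in atTop, ∀ x : Σ i, Fin (L i), v x.1 x.2 t ≠ 0 :=
    eventually_all.2 fun x => (h x.1).eventually_ne_zero (d := L x.1 - 1 - x.2) (by omega)
  filter_upwards [hne] with t ht
  have ha (x : Σ i, Fin (L i)) : accel μ v x.1 x.2 t =
      (μ x.1 + logDerivPart (v x.1) x.2 t) * v x.1 x.2 t := by
    rw [accel, logDerivPart, add_mul, div_mul_cancel₀ _ (ht x)]
  rw [gram, dot_eq_sum_sigma, dot_eq_sum_sigma, dot_eq_sum_sigma, two_mul_gram,
    IsGrowthData.areaSum]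
  simp only [ha, inner_sq_expand]

theorem gram_isBigO_gram {w : ι → ℕ → ℝ → ℂ} (h : ∀ i, IsJordanChain (μ i) (L i) (v i))
    (h' : ∀ i, IsJordanChain (μ i) (L i) (w i)) : gram μ L v =O[atTop] gram μ L w := by
  have h1 := ((isGrowthData h).areaSum_isBigO_areaSum (isGrowthData h')
    (exists_degree_succ μ L)).congr' (two_mul_gram_eventuallyEq h).symm
    (two_mul_gram_eventuallyEq h').symm
  exact (isBigO_const_mul_left_iff two_ne_zero).1 ((isBigO_const_mul_right_iff two_ne_zero).1 h1)

theorem dot_self_isBigO_dot_self {w : ι → ℕ → ℝ → ℂ} (h : ∀ i, IsJordanChain (μ i) (L i) (v i))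
    (h' : ∀ i, IsJordanChain (μ i) (L i) (w i)) : dot L v v =O[atTop] dot L w w :=
  ((isGrowthData h).sum_sq_isBigO_sum_sq (isGrowthData h')).congr
    (fun t => (dot_self_eq v t).symm) fun t => (dot_self_eq w t).symm

/-- The last coordinate of a nonempty chain is a nonzero constant times an exponential, so it never
vanishes. This keeps the denominator of the curvature away from `0` at every time. -/
theorem dot_self_eq_zero_or_forall_ne (h : ∀ i, IsJordanChain (μ i) (L i) (v i)) :
    (∀ t, dot L v v t = 0) ∨ ∀ t, dot L v v t ≠ 0 := by
  by_cases hL : ∀ i, L i = 0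
  · left; intro t; simp [dot, hL]
  right
  push Not at hL
  obtain ⟨i, hi⟩ := hL
  intro t ht
  rw [dot_self_eq, Finset.sum_eq_zero_iff_of_nonneg fun _ _ => by positivity] at ht
  have h1 := ht ⟨i, ⟨L i - 1, by omega⟩⟩ (Finset.mem_univ _)
  have h2 := (h i).eq_exp_mul 1 (L i - 1) (by omega) t
  have h3 := (h i).ne_zero (L i - 1) (by omega)
  simp only [polyPart, Finset.sum_range_one, add_zero, pow_zero, mul_one, Nat.factorial_zero,
    Nat.cast_one, div_one] at h2
  rw [sq_eq_zero_iff, norm_eq_zero] at h1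
  exact mul_ne_zero (Complex.exp_ne_zero _) h3 (h2.symm.trans h1)

end IsJordanChain

/-! ### Curvature of a trajectory as a quotient of exponential polynomials -/

theorem continuous_of_mem_expPoly {f : ℝ → ℝ} (hf : f ∈ expPoly) : Continuous f := by
  obtain ⟨c, rfl⟩ := Finsupp.mem_span_range_iff_exists_finsupp.1 (expPoly_le_span hf)
  have h : (c.sum fun x a => a • expMonomial x) = fun t => ∑ x ∈ c.support,
      c x * (Real.exp ((ofLex x).1 * t) * t ^ (ofLex x).2) := by
    funext t
    simp [Finsupp.sum, Finset.sum_apply, expMonomial]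
  rw [h]
  fun_prop

/-- A comparison principle for squared curvatures which are quotients of exponential
polynomials. -/
theorem sq_curvature_isBigO {ι : Type*} [Fintype ι] {μ : ι → ℂ} {L : ι → ℕ}
    {v w : ι → ℕ → ℝ → ℂ} (h : ∀ i, IsJordanChain (μ i) (L i) (v i))
    (h' : ∀ i, IsJordanChain (μ i) (L i) (w i)) :
    (fun t => IsJordanChain.gram μ L v t / IsJordanChain.dot L v v t ^ 3) =O[atTop]
      fun t => IsJordanChain.gram μ L w t / IsJordanChain.dot L w w t ^ 3 := by
  have hD : IsJordanChain.dot L v v =Θ[atTop] IsJordanChain.dot L w w :=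
    ⟨IsJordanChain.dot_self_isBigO_dot_self h h', IsJordanChain.dot_self_isBigO_dot_self h' h⟩
  exact (IsJordanChain.gram_isBigO_gram h h').mul (hD.pow 3).inv.1

/-- The squared curvature determined by a family of Jordan chains is continuous. -/
theorem continuous_sq_curvature {ι : Type*} [Fintype ι] {μ : ι → ℂ} {L : ι → ℕ}
    {v : ι → ℕ → ℝ → ℂ} (h : ∀ i, IsJordanChain (μ i) (L i) (v i)) :
    Continuous fun t => IsJordanChain.gram μ L v t / IsJordanChain.dot L v v t ^ 3 := by
  rcases IsJordanChain.dot_self_eq_zero_or_forall_ne h with h0 | h0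
  -- With zero velocity the quotient is `0` by the convention on division.
  · simpa [h0] using continuous_const
  · exact (continuous_of_mem_expPoly (IsJordanChain.gram_mem_expPoly h)).div
      ((continuous_of_mem_expPoly (IsJordanChain.dot_self_mem_expPoly h)).pow 3)
      fun t => pow_ne_zero 3 (h0 t)

theorem IsTrajectory.deriv_eq {n : ℕ} {A : Matrix (Fin n) (Fin n) ℝ}
    {r : ℝ → EuclideanSpace ℝ (Fin n)} (hr : IsTrajectory A r) :
    deriv r = fun t => WithLp.toLp 2 (A.mulVec (r t).ofLp) :=
  funext fun t => (hr t).deriv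

theorem IsTrajectory.velocity {n : ℕ} {A : Matrix (Fin n) (Fin n) ℝ}
    {r : ℝ → EuclideanSpace ℝ (Fin n)} (hr : IsTrajectory A r) : IsTrajectory A (deriv r) := by
  rw [hr.deriv_eq]
  exact fun t => ((Matrix.toLpLin 2 2 A).toContinuousLinearMap.hasFDerivAt.comp_hasDerivAt t (hr t))

theorem norm_sub_div_smul_sq {E : Type*} [NormedAddCommGroup E] [InnerProductSpace ℝ E]
    (a v : E) (hv : v ≠ 0) :
    ‖a - (inner ℝ a v / inner ℝ v v) • v‖ ^ 2 =
      (inner ℝ v v * inner ℝ a a - inner ℝ v a ^ 2) / inner ℝ v v := by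
  have h0 : inner ℝ v v ≠ 0 := inner_self_ne_zero.2 hv
  rw [← real_inner_self_eq_norm_sq, inner_sub_sub_self (𝕜 := ℝ)]
  simp only [inner_smul_left, inner_smul_right, real_inner_comm, conj_trivial]
  field_simp
  ring

theorem IsTrajectory.firstCurvature_sq {n : ℕ} {A : Matrix (Fin n) (Fin n) ℝ}
    {r : ℝ → EuclideanSpace ℝ (Fin n)} (hr : IsTrajectory A r) (t : ℝ) :
    firstCurvature r t ^ 2 =
      (inner ℝ (deriv r t) (deriv r t) * inner ℝ (deriv (deriv r) t) (deriv (deriv r) t) -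
        inner ℝ (deriv r t) (deriv (deriv r) t) ^ 2) / inner ℝ (deriv r t) (deriv r t) ^ 3 := by
  by_cases h0 : deriv r t = 0
  · simp [firstCurvature, h0]
  rw [firstCurvature_eq_gramSchmidt r t (hr.velocity t).differentiableAt h0, div_pow,
    norm_sub_div_smul_sq _ _ h0, ← real_inner_self_eq_norm_sq, div_div, ← pow_succ']

theorem firstCurvature_nonneg {n : ℕ} (r : ℝ → EuclideanSpace ℝ (Fin n)) (t : ℝ) :
    0 ≤ firstCurvature r t := by
  unfold firstCurvature; positivity

/-- The part of a vector lying in the `i`-th block. -/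
def blockPart {n q : ℕ} {s : Fin q → ℕ} (e : (Σ i, Fin (s i)) ≃ Fin n)
    (x : EuclideanSpace ℝ (Fin n)) (i : Fin q) (j : Fin (s i)) : ℝ := x (e ⟨i, j⟩)

theorem blockPart_mulVec {n q : ℕ} {s : Fin q → ℕ} (e : (Σ i, Fin (s i)) ≃ Fin n)
    (M : ∀ i, Matrix (Fin (s i)) (Fin (s i)) ℝ) (x : EuclideanSpace ℝ (Fin n)) (i : Fin q) :
    blockPart e (WithLp.toLp 2 ((Matrix.reindex e e (Matrix.blockDiagonal' M)).mulVec x.ofLp)) i =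
      (M i).mulVec (blockPart e x i) := by
  funext j
  change ∑ l, Matrix.reindex e e (Matrix.blockDiagonal' M) (e ⟨i, j⟩) l * x l =
    ∑ l, M i j l * x (e ⟨i, l⟩)
  rw [← Equiv.sum_comp e, Fintype.sum_sigma]
  simp only [Matrix.reindex_apply, Matrix.submatrix_apply, Equiv.symm_apply_apply]
  rw [Finset.sum_eq_single i]
  · simp only [Matrix.blockDiagonal'_apply_eq]
  · intro i' _ hi'
    exact Finset.sum_eq_zero fun j' _ => by
      rw [Matrix.blockDiagonal'_apply_ne _ _ _ hi'.symm, zero_mul]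
  · simp

theorem inner_eq_sum_blockPart {n q : ℕ} {s : Fin q → ℕ} (e : (Σ i, Fin (s i)) ≃ Fin n)
    (x y : EuclideanSpace ℝ (Fin n)) :
    inner ℝ x y = ∑ i, ∑ j, blockPart e x i j * blockPart e y i j := by
  rw [PiLp.inner_apply, ← Equiv.sum_comp e, Fintype.sum_sigma]
  simp [blockPart, mul_comm]

/-- The eigenvalues and chain lengths are chosen before the trajectory, so chains of different
trajectories can be compared. -/
theorem exists_sq_curvature_eq {n : ℕ} {A : Matrix (Fin n) (Fin n) ℝ} (hA : IsRealJordanForm A) :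
    ∃ (q : ℕ) (μ : Fin q → ℂ) (L : Fin q → ℕ), ∀ r : ℝ → EuclideanSpace ℝ (Fin n),
      IsTrajectory A r → r 0 ∈ nonzeroCoordSet n → ∃ v : Fin q → ℕ → ℝ → ℂ,
        (∀ i, IsJordanChain (μ i) (L i) (v i)) ∧ ∀ t, firstCurvature r t ^ 2 =
          IsJordanChain.gram μ L v t / IsJordanChain.dot L v v t ^ 3 := by
  obtain ⟨q, B, hn, rfl⟩ := hA
  set e := finSigmaFinEquiv.trans (finCongr hn) with he
  set A := Matrix.reindex e e (Matrix.blockDiagonal' fun i => (B i).toMatrix) with hA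
  refine ⟨q, fun i => (B i).eig, fun i => (B i).velLen, fun r hr h0 => ?_⟩
  have hc (x : EuclideanSpace ℝ (Fin n)) (i : Fin q) :=
    blockPart_mulVec e (fun i => (B i).toMatrix) x i
  have hchain (i : Fin q) := (B i).isJordanChain_velocity (x := fun t => blockPart e (r t) i)
    (fun j t => by
      rw [← hc]
      exact (EuclideanSpace.proj (𝕜 := ℝ) (e ⟨i, j⟩)).hasFDerivAt.comp_hasDerivAt t (hr t))
    (fun j => (Finset.prod_ne_zero_iff.1 h0) _ (Finset.mem_univ _))
  refine ⟨_, hchain, fun t => ?_⟩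
  have hv (t : ℝ) (i : Fin q) : blockPart e (deriv r t) i =
      (B i).toMatrix.mulVec (blockPart e (r t) i) := by
    rw [hr.deriv_eq]; exact hc _ i
  have ha (t : ℝ) (i : Fin q) : blockPart e (deriv (deriv r) t) i =
      (B i).toMatrix.mulVec ((B i).toMatrix.mulVec (blockPart e (r t) i)) := by
    rw [hr.velocity.deriv_eq, ← hv]; exact hc _ i
  -- The sum stops at `velLen` rather than `len`; the coordinate dropped for eigenvalue `0` is zero
  -- in velocity and acceleration.
  have hinner (x y : EuclideanSpace ℝ (Fin n))
      (hx : ∀ i k, (B i).velLen ≤ k → (B i).coord (blockPart e x i) k = 0) :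
      inner ℝ x y = ∑ i, ∑ k ∈ Finset.range (B i).velLen,
        inner ℝ ((B i).coord (blockPart e x i) k) ((B i).coord (blockPart e y i) k) := by
    rw [inner_eq_sum_blockPart e]
    refine Finset.sum_congr rfl fun i _ => ?_
    rw [(B i).sum_mul_eq_sum_inner]
    refine (Finset.sum_subset (Finset.range_mono (B i).velLen_le_len) fun k _ hk => ?_).symm
    rw [hx i k (not_lt.1 (Finset.mem_range.not.1 hk)), inner_zero_left]
  have hv0 (i : Fin q) (k : ℕ) (hk : (B i).velLen ≤ k) :
      (B i).coord (blockPart e (deriv r t) i) k = 0 := by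
    rw [hv]; exact (hchain i).eq_zero k t hk
  have ha' (i : Fin q) (k : ℕ) : (B i).coord (blockPart e (deriv (deriv r) t) i) k =
      IsJordanChain.accel (fun i => (B i).eig)
        (fun i k t => (B i).coord ((B i).toMatrix.mulVec (blockPart e (r t) i)) k) i k t := by
    rw [ha, RealJordanBlock.coord_mulVec]; rfl
  have ha0 (i : Fin q) (k : ℕ) (hk : (B i).velLen ≤ k) :
      (B i).coord (blockPart e (deriv (deriv r) t) i) k = 0 := by
    rw [ha, RealJordanBlock.coord_mulVec, ← hv, hv0 i k hk, hv0 i (k + 1) (by omega), mul_zero,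
      add_zero]
  rw [hr.firstCurvature_sq, hinner _ _ hv0, hinner _ _ hv0, hinner _ _ ha0]
  simp only [ha', hv]
  rfl

/-! ### From mutual comparison to the four statements -/

theorem tendsto_of_sq {f : ℝ → ℝ} {c : ℝ} (hf : ∀ t, 0 ≤ f t)
    (h : Tendsto (fun t => f t ^ 2) atTop (𝓝 c)) : Tendsto f atTop (𝓝 (√c)) :=
  (h.sqrt).congr fun t => Real.sqrt_sq (hf t)

theorem tendsto_atTop_of_isBigO {f g : ℝ → ℝ} (hf : ∀ t, 0 ≤ f t) (hg : ∀ t, 0 ≤ g t)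
    (h : g =O[atTop] f) (hgt : Tendsto g atTop atTop) : Tendsto f atTop atTop := by
  obtain ⟨c, hc, hb⟩ := h.exists_pos
  refine tendsto_atTop_mono' _ ?_ (hgt.const_mul_atTop (inv_pos.2 hc))
  filter_upwards [hb.bound] with t ht
  rw [Real.norm_of_nonneg (hf t), Real.norm_of_nonneg (hg t)] at ht
  exact (inv_mul_le_iff₀ hc).2 ht

theorem exists_bound_of_isBigO_one {f : ℝ → ℝ} (hf : Continuous f)
    (h : f =O[atTop] fun _ => (1 : ℝ)) : ∃ K, ∀ t, 0 ≤ t → |f t| ≤ K := by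
  obtain ⟨c, hc⟩ := h.bound
  obtain ⟨T, hT⟩ := eventually_atTop.1 hc
  obtain ⟨M, hM⟩ := isCompact_Icc.exists_bound_of_continuousOn (s := Set.Icc 0 T) hf.continuousOn
  refine ⟨max M c, fun t ht => ?_⟩
  rcases le_total t T with h1 | h1
  · exact (hM t ⟨ht, h1⟩).trans (le_max_left _ _)
  · refine le_trans ?_ (le_max_right _ _)
    simpa using hT t h1

theorem theorem5p6 {n : ℕ} (A : Matrix (Fin n) (Fin n) ℝ) (hA : IsRealJordanForm A) :
    ((∃ r : ℝ → EuclideanSpace ℝ (Fin n), IsTrajectory A r ∧ r 0 ∈ nonzeroCoordSet n ∧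
        Tendsto (firstCurvature r) atTop (𝓝 0)) →
      ∀ r : ℝ → EuclideanSpace ℝ (Fin n), IsTrajectory A r → r 0 ∈ nonzeroCoordSet n →
        Tendsto (firstCurvature r) atTop (𝓝 0)) ∧
    ((∃ r : ℝ → EuclideanSpace ℝ (Fin n), IsTrajectory A r ∧ r 0 ∈ nonzeroCoordSet n ∧
        Tendsto (firstCurvature r) atTop atTop) →
      ∀ r : ℝ → EuclideanSpace ℝ (Fin n), IsTrajectory A r → r 0 ∈ nonzeroCoordSet n →
        Tendsto (firstCurvature r) atTop atTop) ∧
    ((∃ r : ℝ → EuclideanSpace ℝ (Fin n), IsTrajectory A r ∧ r 0 ∈ nonzeroCoordSet n ∧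
        ∃ C : ℝ, 0 < C ∧ Tendsto (firstCurvature r) atTop (𝓝 C)) →
      ∀ r : ℝ → EuclideanSpace ℝ (Fin n), IsTrajectory A r → r 0 ∈ nonzeroCoordSet n →
        ∃ C : ℝ, 0 < C ∧ Tendsto (firstCurvature r) atTop (𝓝 C)) ∧
    ((∃ r : ℝ → EuclideanSpace ℝ (Fin n), IsTrajectory A r ∧ r 0 ∈ nonzeroCoordSet n ∧
        ∃ K : ℝ, ∀ t : ℝ, 0 ≤ t → |firstCurvature r t| ≤ K) →
      ∀ r : ℝ → EuclideanSpace ℝ (Fin n), IsTrajectory A r → r 0 ∈ nonzeroCoordSet n →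
        ∃ K : ℝ, ∀ t : ℝ, 0 ≤ t → |firstCurvature r t| ≤ K) := by
  obtain ⟨q, μ, L, H⟩ := exists_sq_curvature_eq hA
  have hO {r s : ℝ → EuclideanSpace ℝ (Fin n)} (hr : IsTrajectory A r)
      (hr0 : r 0 ∈ nonzeroCoordSet n) (hs : IsTrajectory A s) (hs0 : s 0 ∈ nonzeroCoordSet n) :
      (fun t => firstCurvature r t ^ 2) =O[atTop] fun t => firstCurvature s t ^ 2 := by
    obtain ⟨v, hv, hrv⟩ := H r hr hr0
    obtain ⟨w, hw, hsw⟩ := H s hs hs0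
    simp only [hrv, hsw]
    exact sq_curvature_isBigO hv hw
  have hO' {r s : ℝ → EuclideanSpace ℝ (Fin n)} (hr : IsTrajectory A r)
      (hr0 : r 0 ∈ nonzeroCoordSet n) (hs : IsTrajectory A s) (hs0 : s 0 ∈ nonzeroCoordSet n) :
      firstCurvature r =O[atTop] firstCurvature s :=
    (hO hr hr0 hs hs0).of_pow two_ne_zero
  refine ⟨?_, ?_, ?_, ?_⟩
  · rintro ⟨s, hs, hs0, h⟩ r hr hr0
    exact (hO' hr hr0 hs hs0).trans_tendsto h
  · rintro ⟨s, hs, hs0, h⟩ r hr hr0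
    exact tendsto_atTop_of_isBigO (firstCurvature_nonneg r) (firstCurvature_nonneg s)
      (hO' hs hs0 hr hr0) h
  · rintro ⟨s, hs, hs0, C, hC, h⟩ r hr hr0
    obtain ⟨v, hv, hrv⟩ := H r hr hr0
    have h1 : (fun t => firstCurvature r t ^ 2) =O[atTop] fun _ => (1 : ℝ) :=
      (hO hr hr0 hs hs0).trans ((h.pow 2).isBigO_one ℝ)
    have h2 : ∃ l, Tendsto (fun t => firstCurvature r t ^ 2) atTop (𝓝 l) := by
      simp only [hrv] at h1 ⊢
      exact exists_tendsto_div_of_mem_expPoly (IsJordanChain.gram_mem_expPoly hv)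
        (expPoly.pow_mem (IsJordanChain.dot_self_mem_expPoly hv) 3) h1
    obtain ⟨l, hl⟩ := h2
    have h3 := tendsto_of_sq (firstCurvature_nonneg r) hl
    refine ⟨√l, (Real.sqrt_nonneg l).lt_of_ne fun h0 => ?_, h3⟩
    -- If the limit were `0`, comparison in the other direction would force the curvature of `s` to
    -- tend to `0`, against `C > 0`.
    rw [← h0] at h3
    exact hC.ne' (tendsto_nhds_unique h ((hO' hs hs0 hr hr0).trans_tendsto h3))
  · rintro ⟨s, hs, hs0, K, hK⟩ r hr hr0
    obtain ⟨v, hv, hrv⟩ := H r hr hr0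
    -- Continuity passes from `κ²` to `κ` because `κ` is nonnegative, so it is the square root of
    -- its square.
    have hcont : Continuous (firstCurvature r) := by
      have h1 : Continuous fun t => √(firstCurvature r t ^ 2) := by
        simp only [hrv]
        exact (continuous_sq_curvature hv).sqrt
      simpa only [Real.sqrt_sq (firstCurvature_nonneg r _)] using h1
    refine exists_bound_of_isBigO_one hcont ((hO' hr hr0 hs hs0).trans (IsBigO.of_bound K ?_))
    filter_upwards [eventually_ge_atTop 0] with t ht
    simpa using hK t ht
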